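/- Let $(K,v)$ be a non-trivially valued field (the value group $vK$ being an arbitrary ordered abelian group). (1) Suppose that $K$ has characteristic $p>0$ and is Artin-Schreier closed, i.e. $K$ admits no Artin-Schreier extension, where an extension $L|K$ is called an Artin-Schreier extension if $[L:K]=p$ and $L=K(\vartheta)$ for a root $\vartheta$ of a polynomial $X^p-X-a$ with $a\in K$. Then $K$ is dense in its perfect hull $K^{1/p^\infty}$ with respect to the extension of $v$ to $K^{1/p^\infty}$, and the completion of $(K,v)$ is a perfect field. (2) Suppose that $K$ (of arbitrary characteristic) is separable-algebraically closed. Then $K$ is dense in its algebraic closure $\tilde K$ with respect to every extension of $v$ to $\tilde K$. -/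

import Mathlib

universe u

/-- `L | K` is an Artin-Schreier extension of fields of characteristic `p`: an extension of degree
`p` generated by a root `θ` of a polynomial `X ^ p - X - a` with `a ∈ K`. -/
def IsArtinSchreierExtension (p : ℕ) (K L : Type u) [Field K] [Field L] [Algebra K L] : Prop :=
  Module.finrank K L = p ∧
    ∃ θ : L, IntermediateField.adjoin K {θ} = ⊤ ∧ ∃ a : K, θ ^ p - θ - algebraMap K L a = 0

/-- A field `K` of characteristic `p > 0` is Artin-Schreier closed if it admits no Artin-Schreier
extension. (Such extensions are finite over `K`, so it is enough to let `L` range over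
the universe of `K`.) -/
def IsArtinSchreierClosed (p : ℕ) (K : Type u) [Field K] : Prop :=
  ∀ (L : Type u) [Field L] [Algebra K L], ¬ IsArtinSchreierExtension p K L

/-- Let `w` be a valuation on an extension field `L` of `K`. The field `K` is dense in `(L, w)`:
the image of `K` is dense in `L` for the topology defined by `w`. -/
def IsDenseInValued (K : Type*) {L Γ : Type*} [Field K] [Field L] [Algebra K L]
    [LinearOrderedCommGroupWithZero Γ] (w : Valuation L Γ) : Prop :=
  DenseRange fun x : K => WithVal.toVal w (algebraMap K L x)

/-! Let `a` be in `K` and `d ≠ 0` small. A solution of `x ^ p - x = a / d ^ p` gives `y = d * x`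
with `y ^ p - a = d ^ (p - 1) * y`. As `v y ≤ max 1 (v a)`, this is small, so `p`-th powers are
dense in `K`. By induction so are `p ^ n`-th powers, and taking `p ^ n`-th roots makes `K` dense in
every purely inseparable extension. In the completion, Frobenius has closed image, which contains
`K` and hence everything. A separably closed field of characteristic `p` solves these equations
because they are separable, and its algebraic closure is purely inseparable; in characteristic 0 the
two fields coincide. -/

open Polynomial in
theorem X_pow_sub_X_sub_C_natDegree {F : Type*} [Field F] {p : ℕ} (hp : 1 < p) (a : F) :
    (X ^ p - X - C a : F[X]).natDegree = p := by
  rw [natDegree_sub_C, FiniteField.X_pow_card_sub_X_natDegree_eq F hp]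

open Polynomial in
theorem X_pow_sub_X_sub_C_separable {F : Type*} [Field F] (p : ℕ) [CharP F p] (a : F) :
    (X ^ p - X - C a : F[X]).Separable := by
  refine ⟨0, -1, ?_⟩
  simp [derivative_X_pow]

/-- The translates of `θ` by multiples of `n` are roots of the minimal polynomial of `θ`
as soon as `θ + n` is. -/
theorem minpoly_aeval_add_natCast_mul {F E : Type*} [Field F] [Field E] [Algebra F E] {θ : E}
    (hθ : IsIntegral F θ) (c : F) (h : Polynomial.aeval (θ + algebraMap F E c) (minpoly F θ) = 0)
    (k : ℕ) : Polynomial.aeval (θ + k * algebraMap F E c) (minpoly F θ) = 0 := by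
  have hm : (minpoly F θ).comp (Polynomial.X - Polynomial.C c) = minpoly F θ := by
    rw [← minpoly.add_algebraMap]
    exact (minpoly.eq_of_irreducible_of_monic (minpoly.irreducible hθ) h (minpoly.monic hθ)).symm
  induction k with
  | zero => simp
  | succ k ih =>
    rw [← hm, Polynomial.aeval_comp]
    have : Polynomial.aeval (θ + (k + 1 : ℕ) * algebraMap F E c)
        (Polynomial.X - Polynomial.C c) = θ + k * algebraMap F E c := by
      rw [map_sub, Polynomial.aeval_X, Polynomial.aeval_C]
      push_cast
      ring
    rw [this, ih]

open Polynomial in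
/-- A root of `X ^ p - X - a` which does not lie in the base field has degree `p`. -/
theorem minpoly_natDegree_of_pow_sub_self {F E : Type*} [Field F] [Field E] [Algebra F E]
    [IsAlgClosed E] (p : ℕ) [Fact p.Prime] [CharP F p] {θ : E} {a : F}
    (hθ : θ ^ p - θ = algebraMap F E a) (hF : θ ∉ (algebraMap F E).range) :
    (minpoly F θ).natDegree = p := by
  have hp : p.Prime := Fact.out
  have : CharP E p := charP_of_injective_algebraMap (algebraMap F E).injective p
  have hdeg := X_pow_sub_X_sub_C_natDegree hp.one_lt a
  have hf0 : (X ^ p - X - C a : F[X]) ≠ 0 := by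
    intro h
    rw [h, natDegree_zero] at hdeg
    exact hp.ne_zero hdeg.symm
  have hroot : aeval θ (X ^ p - X - C a : F[X]) = 0 := by simp [hθ]
  have hint : IsIntegral F θ := IsAlgebraic.isIntegral ⟨_, hf0, hroot⟩
  have hdvd := minpoly.dvd F θ hroot
  have hsep : (minpoly F θ).Separable := (X_pow_sub_X_sub_C_separable p a).of_dvd hdvd
  refine le_antisymm (hdeg ▸ natDegree_le_of_dvd hdvd hf0) ?_
  have hcard : 1 < Fintype.card ((minpoly F θ).rootSet E) := by
    rw [card_rootSet_eq_natDegree hsep (IsAlgClosed.splits _)]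
    have := minpoly.natDegree_pos hint
    have := mt minpoly.natDegree_eq_one_iff.mp hF
    omega
  obtain ⟨⟨y, hy⟩, hne⟩ := Fintype.exists_ne_of_one_lt_card hcard
    ⟨θ, (mem_rootSet.mpr ⟨minpoly.ne_zero hint, minpoly.aeval F θ⟩)⟩
  have hne : y - θ ≠ 0 := fun h => hne (Subtype.ext (sub_eq_zero.mp h))
  have hy0 := (mem_rootSet.mp hy).2
  have hyp : y ^ p - y = algebraMap F E a := by
    have := aeval_eq_zero_of_dvd_aeval_eq_zero hdvd hy0
    simpa [sub_eq_zero] using this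
  -- The difference of two roots is fixed by Frobenius, hence lies in the prime field.
  have hpow : (y - θ) ^ p = y - θ := by
    rw [sub_pow_char]
    linear_combination hyp - hθ
  obtain ⟨n, hn⟩ := (mem_bot_iff_intCast p E).mp ((Subfield.mem_bot_iff_pow_eq_self E p).mpr hpow)
  have hroots := minpoly_aeval_add_natCast_mul hint (n : F)
    (by rw [map_intCast, hn, add_sub_cancel]; exact hy0)
  rw [map_intCast, hn] at hroots
  have hinj : Set.InjOn (fun k : ℕ => θ + k * (y - θ)) (Finset.range p : Set ℕ) := by
    intro i hi j hj hij
    have := mul_right_cancel₀ hne (add_left_cancel hij)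
    rw [CharP.natCast_eq_natCast E p] at this
    exact Nat.ModEq.eq_of_lt_of_lt this (by simpa using hi) (by simpa using hj)
  classical
  calc p = ((Finset.range p).image fun k : ℕ => θ + k * (y - θ)).card := by
        rw [Finset.card_image_of_injOn hinj, Finset.card_range]
    _ ≤ ((minpoly F θ).aroots E).toFinset.card := by
        refine Finset.card_le_card fun z hz => ?_
        obtain ⟨k, -, rfl⟩ := Finset.mem_image.mp hz
        rw [Multiset.mem_toFinset, mem_aroots]
        exact ⟨minpoly.ne_zero hint, hroots k⟩
    _ ≤ ((minpoly F θ).map (algebraMap F E)).natDegree :=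
        (Multiset.toFinset_card_le _).trans (card_roots' _)
    _ = (minpoly F θ).natDegree := natDegree_map _

/-- A root outside `K` would have degree exactly `p` and so generate an Artin-Schreier extension. -/
theorem IsArtinSchreierClosed.exists_pow_sub_self_eq {K : Type u} [Field K] {p : ℕ}
    [Fact p.Prime] [CharP K p] (h : IsArtinSchreierClosed p K) (c : K) : ∃ x, x ^ p - x = c := by
  have hp : p.Prime := Fact.out
  obtain ⟨θ, hθ⟩ := IsAlgClosed.exists_aeval_eq_zero (AlgebraicClosure K)
    (Polynomial.X ^ p - Polynomial.X - Polynomial.C c : Polynomial K) (by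
      refine Polynomial.degree_ne_of_natDegree_ne ?_
      rw [X_pow_sub_X_sub_C_natDegree hp.one_lt]
      exact hp.ne_zero)
  have hθ : θ ^ p - θ = algebraMap K (AlgebraicClosure K) c := by simpa [sub_eq_zero] using hθ
  by_cases hK : θ ∈ (algebraMap K (AlgebraicClosure K)).range
  · obtain ⟨x, rfl⟩ := hK
    refine ⟨x, (algebraMap K (AlgebraicClosure K)).injective ?_⟩
    simpa using hθ
  · have hint : IsIntegral K θ := Algebra.IsIntegral.isIntegral θ
    have : FiniteDimensional K (IntermediateField.adjoin K {θ}) :=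
      IntermediateField.adjoin.finiteDimensional hint
    have hfin := IntermediateField.adjoin.finrank hint
    refine (h (IntermediateField.adjoin K {θ}) ⟨?_, IntermediateField.AdjoinSimple.gen K θ, ?_,
      c, ?_⟩).elim
    · rw [hfin, minpoly_natDegree_of_pow_sub_self p hθ hK]
    · rw [Field.primitive_element_iff_minpoly_natDegree_eq, IntermediateField.minpoly_gen, hfin]
    · apply Subtype.ext
      simpa [sub_eq_zero] using! hθ

theorem IsSepClosed.exists_pow_sub_self_eq {K : Type*} [Field K] [IsSepClosed K] (p : ℕ)
    [Fact p.Prime] [CharP K p] (c : K) : ∃ x : K, x ^ p - x = c := by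
  have hp : p.Prime := Fact.out
  obtain ⟨x, hx⟩ := IsSepClosed.exists_root
    (Polynomial.X ^ p - Polynomial.X - Polynomial.C c : Polynomial K) (by
      refine Polynomial.degree_ne_of_natDegree_ne ?_
      rw [X_pow_sub_X_sub_C_natDegree hp.one_lt]
      exact hp.ne_zero) (X_pow_sub_X_sub_C_separable p c)
  exact ⟨x, by simpa [sub_eq_zero] using hx⟩

section Approximation

variable {K Γ : Type*} [Field K] [LinearOrderedCommGroupWithZero Γ] {v : Valuation K Γ}

/-- If all Artin-Schreier polynomials have roots in `K`, then `p`-th powers approximate every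
element of `K`. -/
theorem Valuation.exists_pow_sub_lt (hv : v.IsNontrivial) {p : ℕ} (hp : p.Prime)
    (h : ∀ c : K, ∃ x, x ^ p - x = c) (a : K) {e : K} (he : e ≠ 0) :
    ∃ b, v (b ^ p - a) < v e := by
  obtain ⟨m, hm1, hma⟩ : ∃ m, 1 ≤ v m ∧ v a ≤ v m := by
    rcases le_total (v a) 1 with ha | ha
    · exact ⟨1, by simp, by simpa⟩
    · exact ⟨a, ha, le_rfl⟩
  have hm0 : 0 < v m := zero_lt_one.trans_le hm1
  have hve : 0 < v e := v.pos_iff.mpr he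
  obtain ⟨t, ht0, ht1⟩ := (Valuation.isNontrivial_iff_exists_lt_one v).mp hv
  have hvt : 0 < v t := v.pos_iff.mpr ht0
  -- `m` will bound the approximate root `y`, and the error is at most `v d * v y`.
  obtain ⟨d, hd0, hd1, hde⟩ : ∃ d, d ≠ 0 ∧ v d < 1 ∧ v d * v m < v e := by
    rcases le_total (v e) (v m) with hem | hem
    · refine ⟨t * (e / m), mul_ne_zero ht0 (div_ne_zero he (v.pos_iff.mp hm0)), ?_, ?_⟩
      · rw [map_mul, map_div₀]
        exact mul_lt_one_of_lt_of_le ht1 ((div_le_one₀ hm0).mpr hem)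
      · rw [map_mul, map_div₀, mul_assoc, div_mul_cancel₀ _ hm0.ne']
        exact mul_lt_of_lt_one_left hve ht1
    · exact ⟨t, ht0, ht1, (mul_lt_of_lt_one_left hm0 ht1).trans_le hem⟩
  obtain ⟨x, hx⟩ := h (a / d ^ p)
  have hy : (d * x) ^ p - a = d ^ (p - 1) * (d * x) := by
    have : d ^ p = d ^ (p - 1) * d := by rw [← pow_succ, Nat.sub_add_cancel hp.one_le]
    have hx' : d ^ p * (x ^ p - x) = a := by
      rw [hx, mul_div_cancel₀ _ (pow_ne_zero p hd0)]
    rw [mul_pow, ← mul_assoc, ← this, ← hx']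
    ring
  have hd : v d ^ (p - 1) ≤ v d := pow_le_of_le_one zero_le hd1.le (Nat.sub_ne_zero_of_lt hp.one_lt)
  set y := d * x
  have hle : v (y ^ p - a) ≤ v d * v y := by
    rw [hy, map_mul, map_pow]
    exact mul_le_mul_left hd _
  -- Otherwise `v y ≤ v (y ^ p) = v (y ^ p - a) ≤ v d * v y < v y`.
  have hym : v y ≤ v m := by
    by_contra! hmy
    have h1 : 1 ≤ v y := hm1.trans hmy.le
    have hpy : v y ≤ v (y ^ p) := by
      rw [map_pow]
      exact le_self_pow₀ h1 hp.ne_zero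
    have hay : v (y ^ p) = v (y ^ p - a) := by
      rw [Valuation.map_sub_eq_of_lt_left]
      exact (hma.trans_lt hmy).trans_le hpy
    exact (hpy.trans (hay.trans_le hle)).not_gt
      (mul_lt_of_lt_one_left (zero_lt_one.trans_le h1) hd1)
  exact ⟨y, hle.trans_lt ((mul_le_mul_right hym _).trans_lt hde)⟩

theorem Valuation.exists_pow_pow_sub_lt (hv : v.IsNontrivial) {p : ℕ} [Fact p.Prime] [CharP K p]
    (h : ∀ c : K, ∃ x, x ^ p - x = c) (n : ℕ) (a : K) {e : K} (he : e ≠ 0) :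
    ∃ b, v (b ^ p ^ n - a) < v e := by
  have hp : p.Prime := Fact.out
  induction n generalizing e with
  | zero => exact ⟨a, by simpa [zero_lt_iff] using he⟩
  | succ n ih =>
    obtain ⟨b, hb⟩ := ih he
    -- With `v δ ≤ 1`, raising the error to the power `p ^ n` does not enlarge it.
    obtain ⟨δ, hδ0, hδ1, hδe⟩ : ∃ δ, δ ≠ 0 ∧ v δ ≤ 1 ∧ v δ ≤ v e := by
      rcases le_total (v e) 1 with h1 | h1
      · exact ⟨e, he, h1, le_rfl⟩
      · exact ⟨1, one_ne_zero, by simp, by simpa⟩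
    obtain ⟨c, hc⟩ := exists_pow_sub_lt hv hp h b hδ0
    refine ⟨c, ?_⟩
    have : c ^ p ^ (n + 1) - a = (c ^ p - b) ^ p ^ n + (b ^ p ^ n - a) := by
      rw [sub_pow_char_pow, ← pow_mul, pow_succ', sub_add_sub_cancel]
    rw [this]
    refine v.map_add_lt ?_ hb
    rw [map_pow]
    exact ((pow_le_of_le_one zero_le (hc.le.trans hδ1) (pow_ne_zero n hp.ne_zero)).trans_lt
      hc).trans_le hδe

end Approximation

theorem Valued.mem_nhds_iff_exists_ne_zero {R Γ : Type*} [Field R]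
    [LinearOrderedCommGroupWithZero Γ] [Valued R Γ] {s : Set R} {x : R} :
    s ∈ nhds x ↔ ∃ e : R, e ≠ 0 ∧ {y | Valued.v (y - x) < Valued.v e} ⊆ s := by
  rw [Valued.mem_nhds]
  constructor
  · rintro ⟨γ, hγ⟩
    obtain ⟨r, t, hr, ht, h⟩ := Valued.v.exists_div_eq_of_unit γ
    refine ⟨r / t, div_ne_zero (Valued.v.pos_iff.mp hr) (Valued.v.pos_iff.mp ht),
      fun y hy => hγ ?_⟩
    rw [Set.mem_ofPred_eq, ← h, ← map_div₀, Valuation.restrict_lt_iff]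
    exact hy
  · rintro ⟨e, he, h⟩
    refine ⟨Units.mk0 (Valued.v.restrict e) (by simpa using he), fun y hy => h ?_⟩
    simpa using hy

theorem isDenseInValued_of_forall_exists {K L Γ : Type*} [Field K] [Field L] [Algebra K L]
    [LinearOrderedCommGroupWithZero Γ] {w : Valuation L Γ}
    (h : ∀ x e : L, e ≠ 0 → ∃ b : K, w (algebraMap K L b - x) < w e) : IsDenseInValued K w := by
  intro x
  rw [mem_closure_iff_nhds]
  intro s hs
  obtain ⟨e, he, hes⟩ := Valued.mem_nhds_iff_exists_ne_zero.mp hs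
  obtain ⟨b, hb⟩ := h x.ofVal e.ofVal (by simpa using he)
  exact ⟨_, hes hb, b, rfl⟩

theorem Valuation.HasExtension.isNontrivial_comap {K L Γ₀ Γ : Type*} [Field K] [Field L]
    [Algebra K L] [LinearOrderedCommGroupWithZero Γ₀] [LinearOrderedCommGroupWithZero Γ]
    {v : Valuation K Γ₀} (hv : v.IsNontrivial) (w : Valuation L Γ) [v.HasExtension w] :
    (w.comap (algebraMap K L)).IsNontrivial := by
  rw [Valuation.isNontrivial_iff_exists_lt_one] at hv ⊢
  obtain ⟨x, hx, h⟩ := hv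
  exact ⟨x, hx, (Valuation.HasExtension.val_map_lt_one_iff v w x).mpr h⟩

/-- If all Artin-Schreier polynomials have roots in `K`, then `K` is dense in each of its purely
inseparable extensions. -/
theorem isDenseInValued_of_pow_mem {K L Γ : Type*} [Field K] [Field L] [Algebra K L]
    [LinearOrderedCommGroupWithZero Γ] {w : Valuation L Γ}
    (hw : (w.comap (algebraMap K L)).IsNontrivial) {p : ℕ} [Fact p.Prime] [CharP K p]
    (h : ∀ c : K, ∃ x, x ^ p - x = c)
    (hL : ∀ x : L, ∃ (n : ℕ) (y : K), algebraMap K L y = x ^ p ^ n) : IsDenseInValued K w := by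
  have hp : p.Prime := Fact.out
  have : CharP L p := charP_of_injective_algebraMap (algebraMap K L).injective p
  refine isDenseInValued_of_forall_exists fun x e he => ?_
  obtain ⟨n, a, ha⟩ := hL x
  obtain ⟨k, f, hf⟩ := hL e
  have hf0 : f ≠ 0 := by
    rintro rfl
    rw [map_zero] at hf
    exact pow_ne_zero _ he hf.symm
  -- The radius must come from `K`; a power of `e` lies there.
  obtain ⟨g, hg0, hg⟩ : ∃ g : K, g ≠ 0 ∧ w (algebraMap K L g) ≤ w e ^ p ^ n := by
    rcases le_total 1 (w e) with h1 | h1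
    · exact ⟨1, one_ne_zero, by simpa using one_le_pow₀ h1⟩
    · refine ⟨f ^ p ^ n, pow_ne_zero _ hf0, ?_⟩
      rw [map_pow, map_pow, hf, map_pow]
      gcongr
      exact pow_le_of_le_one zero_le h1 (pow_ne_zero k hp.ne_zero)
  obtain ⟨b, hb⟩ := Valuation.exists_pow_pow_sub_lt hw h n a hg0
  rw [Valuation.comap_apply, Valuation.comap_apply, map_sub, map_pow, ha, ← sub_pow_char_pow,
    map_pow] at hb
  exact ⟨b, lt_of_pow_lt_pow_left₀ _ zero_le (hb.trans_le hg)⟩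

/-- The Frobenius endomorphism of a valued field of characteristic `p` is a uniform embedding. -/
theorem Valued.isUniformInducing_frobenius (R : Type*) {Γ : Type*} [Field R]
    [LinearOrderedCommGroupWithZero Γ] [Valued R Γ] (p : ℕ) [Fact p.Prime] [CharP R p] :
    IsUniformInducing (frobenius R p) := by
  have hp : p.Prime := Fact.out
  refine AddMonoidHom.isUniformInducing_of_isInducing ?_
  rw [Topology.isInducing_iff_nhds]
  intro x
  ext s
  rw [Filter.mem_comap, Valued.mem_nhds_iff_exists_ne_zero]
  constructor
  · rintro ⟨e, he, hes⟩
    refine ⟨_, Valued.mem_nhds_iff_exists_ne_zero.mpr ⟨e ^ p, pow_ne_zero p he, subset_rfl⟩,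
      fun y hy => hes ?_⟩
    rw [Set.mem_preimage, Set.mem_ofPred_eq, frobenius_def, frobenius_def, ← sub_pow_char,
      map_pow, map_pow] at hy
    exact lt_of_pow_lt_pow_left₀ _ zero_le hy
  · rintro ⟨t, ht, hts⟩
    obtain ⟨e, he, het⟩ := Valued.mem_nhds_iff_exists_ne_zero.mp ht
    obtain ⟨g, hg0, hg⟩ : ∃ g : R, g ≠ 0 ∧ Valued.v g ^ p ≤ Valued.v e := by
      rcases le_total 1 (Valued.v e) with h1 | h1
      · exact ⟨1, one_ne_zero, by simpa using h1⟩
      · exact ⟨e, he, pow_le_of_le_one zero_le h1 hp.ne_zero⟩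
    refine ⟨g, hg0, fun y hy => hts (het ?_)⟩
    rw [Set.mem_ofPred_eq, frobenius_def, frobenius_def, ← sub_pow_char, map_pow]
    exact (pow_lt_pow_left₀ hy zero_le hp.ne_zero).trans_le hg

theorem perfectField_completion {K Γ₀ : Type*} [Field K] [LinearOrderedCommGroupWithZero Γ₀]
    {v : Valuation K Γ₀} (hv : v.IsNontrivial) {p : ℕ} [Fact p.Prime] [CharP K p]
    (h : ∀ c : K, ∃ x, x ^ p - x = c) : PerfectField v.Completion := by
  have hp : p.Prime := Fact.out
  have : CharP (WithVal v) p :=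
    charP_of_injective_ringHom (f := (WithVal.equiv v).symm.toRingHom)
      (WithVal.equiv v).symm.injective p
  have : CharP v.Completion p := charP_of_injective_ringHom
    (UniformSpace.Completion.coeRingHom (α := WithVal v)).injective p
  have hclosed : IsClosed (Set.range (frobenius v.Completion p)) :=
    (Valued.isUniformInducing_frobenius v.Completion p).isComplete_range.isClosed
  have hsub : Set.range ((↑) : WithVal v → v.Completion) ⊆
      Set.range (frobenius v.Completion p) := by
    rintro _ ⟨a, rfl⟩
    rw [← hclosed.closure_eq, mem_closure_iff_nhds]
    intro s hs
    obtain ⟨e, he, hes⟩ := Valued.mem_nhds_iff_exists_ne_zero.mp hs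
    -- Completing adds no new values, so the radius may be taken in `K`.
    obtain ⟨r, hr⟩ := Valued.exists_coe_eq_v e
    have hr : Valued.v e = v r.ofVal := hr
    obtain ⟨b, hb⟩ := Valuation.exists_pow_sub_lt hv hp h a.ofVal (e := r.ofVal) (by
      rw [← v.ne_zero_iff, ← hr, Valuation.ne_zero_iff]
      exact he)
    refine ⟨_, hes ?_, ((WithVal.toVal v b : WithVal v) : v.Completion), rfl⟩
    have hpow : ((WithVal.toVal v b : WithVal v) : v.Completion) ^ p =
        ((WithVal.toVal v b ^ p : WithVal v) : v.Completion) :=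
      (map_pow (UniformSpace.Completion.coeRingHom (α := WithVal v)) _ _).symm
    rw [Set.mem_ofPred_eq, frobenius_def, hpow, ← UniformSpace.Completion.coe_sub, Valued.valuedCompletion_apply, hr]
    exact hb
  have hsurj : Function.Surjective (frobenius v.Completion p) := by
    rw [← Set.range_eq_univ, ← hclosed.closure_eq]
    exact (UniformSpace.Completion.denseRange_coe.mono hsub).closure_eq
  have : PerfectRing v.Completion p := PerfectRing.ofSurjective _ _ hsurj
  exact PerfectRing.toPerfectField v.Completion p

theorem theorem1p10 {K Γ₀ : Type*} [Field K] [LinearOrderedCommGroupWithZero Γ₀]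
    (v : Valuation K Γ₀) (hv : v.IsNontrivial) :
    (∀ (p : ℕ) [Fact p.Prime] [CharP K p], IsArtinSchreierClosed p K →
      (∀ (L Γ : Type*) [Field L] [Algebra K L] [LinearOrderedCommGroupWithZero Γ]
          [ExpChar L p] [PerfectRing L p] [IsPerfectClosure (algebraMap K L) p]
          (w : Valuation L Γ) [v.HasExtension w], IsDenseInValued K w) ∧
        PerfectField v.Completion) ∧
    (IsSepClosed K →
      ∀ (L Γ : Type*) [Field L] [Algebra K L] [LinearOrderedCommGroupWithZero Γ]
          [IsAlgClosure K L] (w : Valuation L Γ) [v.HasExtension w], IsDenseInValued K w) := by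
  refine ⟨fun p _ _ hAS => ⟨?_, perfectField_completion hv hAS.exists_pow_sub_self_eq⟩, ?_⟩
  · intro L Γ _ _ _ _ _ _ w _
    exact isDenseInValued_of_pow_mem (Valuation.HasExtension.isNontrivial_comap hv w)
      hAS.exists_pow_sub_self_eq (IsPRadical.pow_mem (algebraMap K L) p)
  · intro _ L Γ _ _ _ _ w _
    have : Algebra.IsAlgebraic K L := IsAlgClosure.isAlgebraic
    obtain ⟨q, hq⟩ := CharP.exists K
    rcases CharP.char_is_prime_or_zero K q with hp | rfl
    · have : Fact q.Prime := ⟨hp⟩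
      exact isDenseInValued_of_pow_mem (Valuation.HasExtension.isNontrivial_comap hv w)
        (IsSepClosed.exists_pow_sub_self_eq q) (fun x => IsPurelyInseparable.pow_mem K q x)
    · have : CharZero K := CharP.charP_to_charZero K
      refine isDenseInValued_of_forall_exists fun x e he => ?_
      obtain ⟨b, rfl⟩ := (IsSepClosed.algebraMap_bijective K L).2 x
      exact ⟨b, by simpa [zero_lt_iff] using he⟩
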